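/- **Setting.** A unit mass of agents has risk types $\theta\in\Theta=[\underline\theta,\bar\theta]$, $\underline\theta<\bar\theta$, with distribution function $F$ and continuous density $f>0$ on $\Theta$. An agent of type $\theta$ has a valuation in $B=[0,\bar b)$, $0<\bar b\le\infty$, with distribution function $H_\theta$ (so $H_\theta=1$ on $[\bar b,\infty)$). The $H_\theta$ are non-decreasing in $\theta$ in the sense of first-order stochastic dominance; $H_\theta(b)$ is continuously differentiable in $\theta\in\Theta$ for each $b\in B$; $H_\theta(\cdot)$ is continuously differentiable on $B$ with derivative $h_\theta>0$; and $\partial^2H_\theta(b)/\partial b\,\partial\theta$ exists and is continuous on $\Theta\times B$. The distortion $g:[0,1]\to[0,1]$ is non-decreasing and continuously differentiable with $g(q)\le q$, $g(0)=0$, $g(1)=1$. The supply $S:\mathbb R_+\to\mathbb R_+$ is strictly increasing, continuously differentiable and unbounded, with $S(0)=0$. For a price $p$ let $RS(p)=S(p)-\int_\Theta[1-H_\theta(p)]f(\theta)\,d\theta$ and $$J_p(\theta,b)=\Big[1-g(H_\theta(b))+\tfrac{1-F(\theta)}{f(\theta)}\,g'(H_\theta(b))\,\tfrac{\partial H_\theta(b)}{\partial\theta}\Big]\tfrac1{h_\theta(b)}+b-p-\tfrac{1-H_\theta(b)}{h_\theta(b)}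 .$$ Let $p^N>0$ be the price with $S(p^N)=\int_\Theta[1-H_\theta(p^N)]f(\theta)\,d\theta$ (market clearing without coverage) and $p^F>0$ the price with $S(p^F)=\int_\Theta[1-H_\theta(0)]f(\theta)\,d\theta$ (market clearing under full coverage). *First stage.* For $p\in[p^N,p^F]$ and an uninsured-price premium $\beta\ge0$ (the uninsured pay $\beta+p$), the insurer's profit is $$\Pi_\beta(p)=\max_x\int_\Theta\int_{B\cap[0,p]}x(\theta,b)J_p(\theta,b)h_\theta(b)\,db\,f(\theta)\,d\theta+K_\beta(p),$$ $$K_\beta(p)=\int_0^{\beta+p}[1-g(H_{\underline\theta}(b))]\,db-\int_0^{p}[1-g(H_{\underline\theta}(b))]\,db,$$ over the measurable $x:\Theta\times B\to[0,1]$ that are non-decreasing in $b$ and satisfy $\int_\Theta\int_{B\cap[0,p]}x(\theta,b)h_\theta(b)\,db\,f(\theta)\,d\theta=RS(p)$. *Second stage.* A price $p$ solves the second-stage problem under $\beta$ if $p\in[p^N,p^F]$ and $\Pi_\beta(p)\ge\Pi_\beta(q)$ for all $q\in[p^N,p^F]$. **Corollary.** Let $\beta>\beta'\ge0$. Then there does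 not exist a price $p$ that solves the second-stage problem under $\beta$ and is strictly greater than all prices that solve the second-stage problem under $\beta'$. -/

import Mathlib

open MeasureTheory Set

/-- The primitives of the model. -/
structure InsuranceMarket where
  /-- lowest risk type -/
  θlo : ℝ
  /-- highest risk type -/
  θhi : ℝ
  /-- the supremum of the valuations, possibly `⊤` -/
  bbar : EReal
  /-- the law of the valuation of an agent with risk type `θ` -/
  valuation : ℝ → Measure ℝ
  /-- the density of the risk types -/
  f : ℝ → ℝ
  /-- the probability distortion of the dual utility -/
  g : ℝ → ℝ
  /-- the supply of services -/
  S : ℝ → ℝ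

noncomputable section

namespace InsuranceMarket

/-- The set of risk types `Θ`. -/
def Θ (M : InsuranceMarket) : Set ℝ := Icc M.θlo M.θhi

/-- The set of valuations `B = [0, bbar)`. -/
def B (M : InsuranceMarket) : Set ℝ := {b | 0 ≤ b ∧ (b : EReal) < M.bbar}

/-- The distribution function `H_θ` of the valuation. As a distribution function on the whole
line it equals `1` at and above `bbar`. -/
def H (M : InsuranceMarket) (θ b : ℝ) : ℝ := ProbabilityTheory.cdf (M.valuation θ) b

/-- `h_θ(b) = ∂H_θ(b)/∂b`, for `b ∈ B` (one-sided at `b = 0`). -/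
def h (M : InsuranceMarket) (θ b : ℝ) : ℝ := derivWithin (fun c => M.H θ c) M.B b

/-- `∂H_θ(b)/∂θ`, for `θ ∈ Θ` (one-sided at the end points of `Θ`). -/
def dH (M : InsuranceMarket) (θ b : ℝ) : ℝ := derivWithin (fun s => M.H s b) M.Θ θ

/-- The cross partial derivative `∂²H_θ(b)/∂b∂θ`. -/
def crossH (M : InsuranceMarket) (θ b : ℝ) : ℝ := derivWithin (fun c => M.dH θ c) M.B b

/-- The distribution function of the risk types. -/
def F (M : InsuranceMarket) (θ : ℝ) : ℝ := ∫ s in M.θlo..θ, M.f s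

/-- The derivative of the distortion on `[0,1]`. -/
def g' (M : InsuranceMarket) (q : ℝ) : ℝ := derivWithin M.g (Icc 0 1) q

/-- The standing assumptions of the model. -/
structure Regular (M : InsuranceMarket) : Prop where
  type_lt : M.θlo < M.θhi
  bbar_pos : 0 < M.bbar
  -- each `H_θ` is a probability distribution on `B`
  prob : ∀ θ ∈ M.Θ, IsProbabilityMeasure (M.valuation θ)
  supp : ∀ θ ∈ M.Θ, M.valuation θ M.Bᶜ = 0
  -- first-order stochastic dominance
  fosd : ∀ b, AntitoneOn (fun θ => M.H θ b) M.Θ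
  -- regularity of the valuation distributions
  smooth_b : ∀ θ ∈ M.Θ, ContDiffOn ℝ 1 (fun b => M.H θ b) M.B
  h_pos : ∀ θ ∈ M.Θ, ∀ b ∈ M.B, 0 < M.h θ b
  smooth_θ : ∀ b ∈ M.B, ContDiffOn ℝ 1 (fun θ => M.H θ b) M.Θ
  cross_exists : ∀ θ ∈ M.Θ, DifferentiableOn ℝ (fun b => M.dH θ b) M.B
  cross_cont : ContinuousOn (fun z : ℝ × ℝ => M.crossH z.1 z.2) (M.Θ ×ˢ M.B)
  -- the risk types have a continuous positive probability density
  f_cont : ContinuousOn M.f M.Θ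
  f_pos : ∀ θ ∈ M.Θ, 0 < M.f θ
  f_mass : ∫ θ in M.θlo..M.θhi, M.f θ = 1
  -- the distortion
  g_mono : MonotoneOn M.g (Icc 0 1)
  g_smooth : ContDiffOn ℝ 1 M.g (Icc 0 1)
  g_le : ∀ q ∈ Icc (0 : ℝ) 1, M.g q ≤ q
  g_zero : M.g 0 = 0
  g_one : M.g 1 = 1
  -- the supply
  S_mono : StrictMonoOn M.S (Ici 0)
  S_smooth : ContDiffOn ℝ 1 M.S (Ici 0)
  S_unbounded : ¬ BddAbove (M.S '' Ici 0)
  S_zero : M.S 0 = 0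

/-- The set of valuations in `[0, p]`; it is all of `B` when `p` is at least `bbar`. -/
def lowValuations (M : InsuranceMarket) (p : ℝ) : Set ℝ := M.B ∩ Iic p

/-- The demand at price `p` of the agents with a valuation of at most `p` who are allotted
the quantities `x(θ, b)`. -/
def insuredDemand (M : InsuranceMarket) (x : ℝ → ℝ → ℝ) (p : ℝ) : ℝ :=
  ∫ θ in M.θlo..M.θhi, (∫ b in M.lowValuations p, x θ b * M.h θ b) * M.f θ

/-- The demand at price `p` of the agents with a valuation above `p`. -/
def highDemand (M : InsuranceMarket) (p : ℝ) : ℝ :=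
  ∫ θ in M.θlo..M.θhi, (1 - M.H θ p) * M.f θ

/-- The total demand `𝒟(x; p)`. -/
def demand (M : InsuranceMarket) (x : ℝ → ℝ → ℝ) (p : ℝ) : ℝ :=
  M.insuredDemand x p + M.highDemand p

/-- The residual supply `RS(p)`. -/
def RS (M : InsuranceMarket) (p : ℝ) : ℝ := M.S p - M.highDemand p

/-- `p` is the price `p^N` that clears the market without any coverage. -/
def IsNoCoveragePrice (M : InsuranceMarket) (p : ℝ) : Prop :=
  0 < p ∧ M.demand (fun _ _ => 0) p = M.S p

/-- `p` is the price `p^F` that clears the market under full coverage. -/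
def IsFullCoveragePrice (M : InsuranceMarket) (p : ℝ) : Prop :=
  0 < p ∧ M.demand (fun _ _ => 1) p = M.S p

/-- The virtual value `J(θ, b)` at price `p`. -/
def J (M : InsuranceMarket) (p θ b : ℝ) : ℝ :=
  (1 - M.g (M.H θ b) + (1 - M.F θ) / M.f θ * M.g' (M.H θ b) * M.dH θ b) * (1 / M.h θ b)
    + (b - p - (1 - M.H θ b) / M.h θ b)

/-- The non-participation payoff of type `θ` at price `p`, when the uninsured pay `β + p`. -/
def UNP (M : InsuranceMarket) (β p θ : ℝ) : ℝ :=
  -∫ b in (0 : ℝ)..(β + p), (1 - M.g (M.H θ b))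

/-- The constant `K(p)` of the insurer's profit. -/
def K (M : InsuranceMarket) (β p : ℝ) : ℝ :=
  -M.UNP β p M.θlo - ∫ b in (0 : ℝ)..p, (1 - M.g (M.H M.θlo b))

/-- The insurer's profit from the allocation `x` at price `p`. -/
def profit (M : InsuranceMarket) (β p : ℝ) (x : ℝ → ℝ → ℝ) : ℝ :=
  (∫ θ in M.θlo..M.θhi,
    (∫ b in M.lowValuations p, x θ b * M.J p θ b * M.h θ b) * M.f θ) + M.K β p

/-- The constraints of the first-stage problem at price `p`: `x` is a (measurable) allocation of
quantities in `[0,1]`, non-decreasing in the valuation, and the market clears. -/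
structure Feasible (M : InsuranceMarket) (p : ℝ) (x : ℝ → ℝ → ℝ) : Prop where
  meas : Measurable (Function.uncurry x)
  mem : ∀ θ ∈ M.Θ, ∀ b ∈ M.B, x θ b ∈ Icc (0 : ℝ) 1
  mono : ∀ θ ∈ M.Θ, MonotoneOn (x θ) M.B
  eq : M.insuredDemand x p = M.RS p

/-- The value `Π(p)` of the first-stage problem under the uninsured-price premium `β`. -/
def Profit (M : InsuranceMarket) (β p : ℝ) : ℝ :=
  sSup {v | ∃ x, M.Feasible p x ∧ v = M.profit β p x}

/-- `p` solves the second-stage problem: it maximizes `Π` over `[p^N, p^F]`. -/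
def SolvesSecondStage (M : InsuranceMarket) (pN pF β p : ℝ) : Prop :=
  p ∈ Icc pN pF ∧ IsMaxOn (M.Profit β) (Icc pN pF) p

end InsuranceMarket

end

/-! The premium enters the first-stage problem only through `K`, since neither the constraints nor
the virtual value involve it. Changing the premium therefore shifts the value at `p` by exactly `M.K
β p - M.K β' p` (`Profit_sub_Profit`). After a translation this shift is the integral of `1 - g(H(b
+ p))` over the fixed interval from `β'` to `β`, hence non-increasing in `p` (`antitone_K_sub`). So
if `p` is optimal under `β`, no lower price beats `p` under the smaller premium `β'`. A maximizer of
the `β'`-value over `[p, pF]` is then a maximizer over all of `[pN, pF]`, and it is at least `p`.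

The analytic work is to show that this maximizer exists. `upperSemicontinuousOn_Profit` suffices on
a compact interval. Its proof takes an allocation feasible at a nearby price `q`, repairs it to be
feasible at `p` by a change that is small in demand (`exists_feasible_near`), and shows that the
profit then changes little, uniformly over allocations (`exists_delta_integral_mul_le`). This needs
the weighted virtual value to be integrable, although `h` and `∂H/∂θ` need not be bounded. Their
integrability comes from monotonicity of `H` in each variable, as their integrals are increments of
a function with values in `[0,1]`. -/

open Filter Topology

noncomputable section

namespace InsuranceMarket

variable {M : InsuranceMarket}

/-! ### Measurability from one-sided limits -/

/-- The slopes along `x + 1/(n+1)` tend to the one-sided derivative. -/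
theorem tendsto_slope_of_hasDerivWithinAt {u : ℝ → ℝ} {u' x : ℝ} {s : Set ℝ}
    (hu : HasDerivWithinAt u u' s x)
    (hs : ∀ᶠ n : ℕ in atTop, x + 1 / ((n : ℝ) + 1) ∈ s) :
    Tendsto (fun n : ℕ => slope u x (x + 1 / ((n : ℝ) + 1))) atTop (𝓝 u') := by
  refine (hasDerivWithinAt_iff_tendsto_slope.1 hu).comp (tendsto_nhdsWithin_iff.2 ⟨?_, ?_⟩)
  · simpa using tendsto_const_nhds.add (tendsto_one_div_add_atTop_nhds_zero_nat (𝕜 := ℝ))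
  · filter_upwards [hs] with n hn
    refine ⟨hn, ?_⟩
    have : (0 : ℝ) < 1 / ((n : ℝ) + 1) := by positivity
    simp only [mem_singleton_iff]
    linarith

/-- A function that is measurable in the first and right-continuous in the second variable is
jointly measurable. -/
theorem measurable_uncurry_of_rightContinuous {u : ℝ → ℝ → ℝ}
    (h₁ : ∀ b, Measurable fun θ => u θ b) (h₂ : ∀ θ b, ContinuousWithinAt (u θ) (Ici b) b) :
    Measurable (Function.uncurry u) := by
  -- The next point above `b` on the grid of mesh `1/(n+1)`. It approaches `b` from the right, and
  -- it depends on `b` only through an integer, so measurability of the sections is enough.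
  let e : ℕ → ℝ → ℝ := fun n b => ((⌊b * ((n : ℝ) + 1)⌋ : ℤ) + 1 : ℝ) / ((n : ℝ) + 1)
  have he : ∀ n b, b ≤ e n b ∧ e n b ≤ b + 1 / ((n : ℝ) + 1) := by
    intro n b
    have hn : (0 : ℝ) < (n : ℝ) + 1 := by positivity
    constructor
    · rw [le_div_iff₀ hn]
      exact (Int.lt_floor_add_one _).le
    · rw [div_le_iff₀ hn, add_mul, one_div, inv_mul_cancel₀ hn.ne']
      linarith [Int.floor_le (b * ((n : ℝ) + 1))]
  refine measurable_of_tendsto_metrizable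
    (f := fun (n : ℕ) (z : ℝ × ℝ) => u z.1 (e n z.2)) (fun n => ?_) ?_
  · have : Measurable fun z : ℝ × ℤ => u z.1 (((z.2 : ℝ) + 1) / ((n : ℝ) + 1)) :=
      measurable_from_prod_countable_left fun k => h₁ (((k : ℝ) + 1) / ((n : ℝ) + 1))
    exact this.comp (measurable_fst.prodMk (Int.measurable_floor.comp (measurable_snd.mul_const _)))
  · refine tendsto_pi_nhds.2 fun z => ?_
    refine (h₂ z.1 z.2).tendsto.comp (tendsto_nhdsWithin_iff.2 ⟨?_, ?_⟩)
    · refine tendsto_of_tendsto_of_tendsto_of_le_of_le tendsto_const_nhds ?_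
        (fun n => (he n z.2).1) (fun n => (he n z.2).2)
      simpa using tendsto_const_nhds.add (tendsto_one_div_add_atTop_nhds_zero_nat (𝕜 := ℝ))
    · exact Eventually.of_forall fun n => (he n z.2).1

/-! ### The valuation distributions and their partial derivatives -/

theorem isOpen_lt_bbar (M : InsuranceMarket) : IsOpen {b : ℝ | (b : EReal) < M.bbar} :=
  isOpen_lt continuous_coe_real_ereal continuous_const

theorem measurableSet_B (M : InsuranceMarket) : MeasurableSet M.B :=
  measurableSet_Ici.inter M.isOpen_lt_bbar.measurableSet

theorem measurableSet_lowValuations (M : InsuranceMarket) (p : ℝ) :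
    MeasurableSet (M.lowValuations p) :=
  M.measurableSet_B.inter measurableSet_Iic

theorem lowValuations_subset_Icc (M : InsuranceMarket) (p : ℝ) : M.lowValuations p ⊆ Icc 0 p :=
  fun _ hb => ⟨hb.1.1, hb.2⟩

theorem lowValuations_inter_Iic (M : InsuranceMarket) {p P : ℝ} (h : p ≤ P) :
    M.lowValuations P ∩ Iic p = M.lowValuations p := by
  ext b
  simp only [lowValuations, mem_inter_iff, mem_Iic]
  exact ⟨fun hb => ⟨hb.1.1, hb.2⟩, fun hb => ⟨⟨hb.1, hb.2.trans h⟩, hb.2⟩⟩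

theorem mem_B_of_le {b c : ℝ} (hc : c ∈ M.B) (h0 : 0 ≤ b) (hb : b ≤ c) : b ∈ M.B :=
  ⟨h0, lt_of_le_of_lt (EReal.coe_le_coe_iff.2 hb) hc.2⟩

theorem H_mem_Icc (M : InsuranceMarket) (θ b : ℝ) : M.H θ b ∈ Icc (0 : ℝ) 1 :=
  ⟨ProbabilityTheory.cdf_nonneg _ _, ProbabilityTheory.cdf_le_one _ _⟩

theorem monotone_H (M : InsuranceMarket) (θ : ℝ) : Monotone (M.H θ) :=
  ProbabilityTheory.monotone_cdf _

/-- The distribution function with the type clamped to `Θ`. -/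
def Hclamp (M : InsuranceMarket) (θ b : ℝ) : ℝ := M.H (max M.θlo (min M.θhi θ)) b

theorem Hclamp_eq {θ : ℝ} (hθ : θ ∈ M.Θ) (b : ℝ) : M.Hclamp θ b = M.H θ b := by
  rw [Hclamp, min_eq_right hθ.2, max_eq_right hθ.1]

namespace Regular

variable (hM : M.Regular)
include hM

theorem clamp_mem (θ : ℝ) : max M.θlo (min M.θhi θ) ∈ M.Θ :=
  ⟨le_max_left _ _, max_le hM.type_lt.le (min_le_left _ _)⟩

theorem antitone_Hclamp (b : ℝ) : Antitone fun θ => M.Hclamp θ b := fun _ _ h =>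
  hM.fosd b (hM.clamp_mem _) (hM.clamp_mem _) (max_le_max le_rfl (min_le_min le_rfl h))

theorem measurable_Hclamp : Measurable (Function.uncurry M.Hclamp) :=
  measurable_uncurry_of_rightContinuous (fun b => (hM.antitone_Hclamp b).measurable)
    fun _ b => StieltjesFunction.right_continuous _ b

theorem hasDerivWithinAt_H {θ b : ℝ} (hθ : θ ∈ M.Θ) (hb : b ∈ M.B) :
    HasDerivWithinAt (M.H θ) (M.h θ b) M.B b :=
  ((hM.smooth_b θ hθ).differentiableOn one_ne_zero b hb).hasDerivWithinAt

theorem hasDerivAt_H {θ b : ℝ} (hθ : θ ∈ M.Θ) (hb : b ∈ M.B) (h0 : 0 < b) :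
    HasDerivAt (M.H θ) (M.h θ b) b :=
  (hM.hasDerivWithinAt_H hθ hb).hasDerivAt
    (inter_mem (Ici_mem_nhds h0) (M.isOpen_lt_bbar.mem_nhds hb.2))

theorem hasDerivWithinAt_H_type {θ b : ℝ} (hθ : θ ∈ M.Θ) (hb : b ∈ M.B) :
    HasDerivWithinAt (fun s => M.H s b) (M.dH θ b) M.Θ θ :=
  ((hM.smooth_θ b hb).differentiableOn one_ne_zero θ hθ).hasDerivWithinAt

theorem dH_nonpos (θ b : ℝ) : M.dH θ b ≤ 0 := (hM.fosd b).derivWithin_nonpos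

theorem tendsto_slope_h {θ b : ℝ} (hθ : θ ∈ M.Θ) (hb : b ∈ M.B) :
    Tendsto (fun n : ℕ => slope (M.Hclamp θ) b (b + 1 / ((n : ℝ) + 1))) atTop (𝓝 (M.h θ b)) := by
  have : M.Hclamp θ = M.H θ := funext fun b => Hclamp_eq hθ b
  rw [this]
  refine tendsto_slope_of_hasDerivWithinAt (hM.hasDerivWithinAt_H hθ hb) ?_
  have h1 : Tendsto (fun n : ℕ => b + 1 / ((n : ℝ) + 1)) atTop (𝓝 b) := by
    simpa using tendsto_const_nhds.add (tendsto_one_div_add_atTop_nhds_zero_nat (𝕜 := ℝ))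
  filter_upwards [h1 (M.isOpen_lt_bbar.mem_nhds hb.2)] with n hn
  exact ⟨add_nonneg hb.1 (by positivity), hn⟩

theorem tendsto_slope_dH {θ b : ℝ} (hθ : θ ∈ Ioo M.θlo M.θhi) (hb : b ∈ M.B) :
    Tendsto (fun n : ℕ => slope (fun s => M.Hclamp s b) θ (θ + 1 / ((n : ℝ) + 1))) atTop
      (𝓝 (M.dH θ b)) := by
  have hΘ : θ ∈ M.Θ := Ioo_subset_Icc_self hθ
  have hd : HasDerivWithinAt (fun s => M.Hclamp s b) (M.dH θ b) M.Θ θ :=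
    (hM.hasDerivWithinAt_H_type hΘ hb).congr (fun s hs => Hclamp_eq hs b) (Hclamp_eq hΘ b)
  refine tendsto_slope_of_hasDerivWithinAt hd ?_
  have h1 : Tendsto (fun n : ℕ => θ + 1 / ((n : ℝ) + 1)) atTop (𝓝 θ) := by
    simpa using tendsto_const_nhds.add (tendsto_one_div_add_atTop_nhds_zero_nat (𝕜 := ℝ))
  filter_upwards [h1 (Icc_mem_nhds hθ.1 hθ.2)] with n hn
  exact hn

theorem H_eq_one {θ b : ℝ} (hθ : θ ∈ M.Θ) (hb : M.bbar ≤ b) : M.H θ b = 1 := by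
  have := hM.prob θ hθ
  rw [H, ProbabilityTheory.cdf_eq_real, measureReal_def, ENNReal.toReal_eq_one_iff]
  refine le_antisymm prob_le_one ?_
  have h1 : M.valuation θ M.B = 1 := (prob_compl_eq_zero_iff M.measurableSet_B).1 (hM.supp θ hθ)
  rw [← h1]
  refine measure_mono fun c hc => ?_
  exact EReal.coe_le_coe_iff.1 (hc.2.le.trans hb)

/-- A jump of the distribution function would be an atom outside the support. The case of interest
is `b = bbar`, where differentiability on `B` says nothing. -/
theorem continuousAt_H_of_notMem {θ b : ℝ} (hθ : θ ∈ M.Θ) (hb : b ∉ M.B) :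
    ContinuousAt (M.H θ) b := by
  have := hM.prob θ hθ
  have h0 : M.valuation θ {b} = 0 :=
    measure_mono_null (singleton_subset_iff.2 hb) (hM.supp θ hθ)
  rw [← ProbabilityTheory.measure_cdf (M.valuation θ), StieltjesFunction.measure_singleton,
    ENNReal.ofReal_eq_zero] at h0
  have hl : ContinuousWithinAt (M.H θ) (Iio b) b := by
    rw [(M.monotone_H θ).continuousWithinAt_Iio_iff_leftLim_eq]
    exact le_antisymm ((M.monotone_H θ).leftLim_le le_rfl) (sub_nonpos.1 h0)
  exact continuousAt_iff_continuous_left'_right'.2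
    ⟨hl, (StieltjesFunction.right_continuous _ b).mono Ioi_subset_Ici_self⟩

/-- The density integrates over the valuations up to `p` to the increment of `H_θ`. -/
theorem integral_h {θ p : ℝ} (hθ : θ ∈ M.Θ) (hp : 0 ≤ p) :
    IntegrableOn (M.h θ) (M.lowValuations p) ∧
      ∫ b in M.lowValuations p, M.h θ b = M.H θ p - M.H θ 0 := by
  -- The effective upper end is `c = min p bbar`: up to a null set the domain is `(0, c]`, and `H`
  -- is constant from `c` to `p`.
  obtain ⟨c, hc0, hcB, hlow, hcont, hcp⟩ : ∃ c : ℝ, 0 ≤ c ∧ (∀ b, 0 ≤ b → b < c → b ∈ M.B) ∧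
      M.lowValuations p =ᵐ[volume] Ioc 0 c ∧ ContinuousOn (M.H θ) (Icc 0 c) ∧
      M.H θ c = M.H θ p := by
    by_cases h : (p : EReal) < M.bbar
    · have hpB : p ∈ M.B := ⟨hp, h⟩
      have hl : M.lowValuations p = Icc 0 p := subset_antisymm (M.lowValuations_subset_Icc p)
        fun b hb => ⟨mem_B_of_le hpB hb.1 hb.2, hb.2⟩
      refine ⟨p, hp, fun b h0 hb => mem_B_of_le hpB h0 hb.le, ?_, ?_, rfl⟩
      · rw [hl]
        exact Ioc_ae_eq_Icc.symm
      · exact (hM.smooth_b θ hθ).continuousOn.mono fun b hb => mem_B_of_le hpB hb.1 hb.2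
    · rw [not_lt] at h
      have hreal : ((M.bbar.toReal : ℝ) : EReal) = M.bbar :=
        EReal.coe_toReal (fun h' => by simp [h'] at h) (fun h' => by
          have := hM.bbar_pos
          simp [h'] at this)
      set c := M.bbar.toReal with hc
      have hc0 : 0 < c := by
        have := hM.bbar_pos
        rw [← hreal] at this
        exact_mod_cast this
      have hcp : c ≤ p := by
        rw [← hreal] at h
        exact_mod_cast h
      have hB : ∀ b, b ∈ M.B ↔ 0 ≤ b ∧ b < c := fun b => by
        rw [B, mem_ofPred_eq, ← hreal, EReal.coe_lt_coe_iff]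
      have hl : M.lowValuations p = Ico 0 c := by
        ext b
        simp only [lowValuations, mem_inter_iff, hB, mem_Iic, mem_Ico]
        exact ⟨fun h => h.1, fun h => ⟨h, h.2.le.trans hcp⟩⟩
      refine ⟨c, hc0.le, fun b h0 hb => (hB b).2 ⟨h0, hb⟩, ?_, ?_, ?_⟩
      · rw [hl]
        exact Ico_ae_eq_Ioc
      · intro b hb
        rcases hb.2.eq_or_lt with rfl | hlt
        · exact (hM.continuousAt_H_of_notMem hθ fun h => (((hB _).1 h).2).false).continuousWithinAt
        · have hbB := (hB b).2 ⟨hb.1, hlt⟩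
          rcases hb.1.eq_or_lt with rfl | hpos
          -- An atom at `0` is allowed, so only right continuity is available here; it is enough on
          -- `[0, c]`.
          · exact (StieltjesFunction.right_continuous _ _).mono Icc_subset_Ici_self
          · exact (hM.hasDerivAt_H hθ hbB hpos).continuousAt.continuousWithinAt
      · rw [hM.H_eq_one hθ h, hM.H_eq_one hθ hreal.ge]
  have hd : ∀ b ∈ Ioo 0 c, HasDerivAt (M.H θ) (M.h θ b) b := fun b hb =>
    hM.hasDerivAt_H hθ (hcB b hb.1.le hb.2) hb.1
  -- The density may blow up near `bbar`; a nonnegative derivative of a continuous function is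
  -- integrable anyway.
  have hi : IntegrableOn (M.h θ) (Ioc 0 c) := intervalIntegral.integrableOn_deriv_of_nonneg hcont hd
    fun b hb => (hM.h_pos θ hθ b (hcB b hb.1.le hb.2)).le
  refine ⟨hi.congr_set_ae hlow, ?_⟩
  rw [setIntegral_congr_set hlow, ← intervalIntegral.integral_of_le hc0, ← hcp]
  exact intervalIntegral.integral_eq_sub_of_hasDerivAt_of_le hc0 hcont hd
    ((intervalIntegrable_iff_integrableOn_Ioc_of_le hc0).2 hi)

/-- The derivative in the type integrates to the increment over `Θ`. -/
theorem integral_dH {b : ℝ} (hb : b ∈ M.B) :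
    IntegrableOn (fun θ => M.dH θ b) (Ioo M.θlo M.θhi) ∧
      ∫ θ in Ioo M.θlo M.θhi, M.dH θ b = M.H M.θhi b - M.H M.θlo b := by
  have hcont : ContinuousOn (fun θ => M.H θ b) (Icc M.θlo M.θhi) := (hM.smooth_θ b hb).continuousOn
  have hd : ∀ θ ∈ Ioo M.θlo M.θhi, HasDerivAt (fun θ => M.H θ b) (M.dH θ b) θ := fun θ hθ =>
    (hM.hasDerivWithinAt_H_type (Ioo_subset_Icc_self hθ) hb).hasDerivAt (Icc_mem_nhds hθ.1 hθ.2)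
  have hi : IntegrableOn (fun θ => -M.dH θ b) (Ioc M.θlo M.θhi) :=
    intervalIntegral.integrableOn_deriv_of_nonneg hcont.neg (fun θ hθ => (hd θ hθ).neg)
      fun θ _ => neg_nonneg.2 (hM.dH_nonpos θ b)
  have hi' : IntegrableOn (fun θ => M.dH θ b) (Ioc M.θlo M.θhi) := by simpa using hi.neg
  refine ⟨hi'.mono_set Ioo_subset_Ioc_self, ?_⟩
  rw [← integral_Ioc_eq_integral_Ioo, ← intervalIntegral.integral_of_le hM.type_lt.le]
  exact intervalIntegral.integral_eq_sub_of_hasDerivAt_of_le hM.type_lt.le hcont hd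
    ((intervalIntegrable_iff_integrableOn_Ioc_of_le hM.type_lt.le).2 hi')

end Regular

/-! ### The product measure on types and valuations -/

/-- Lebesgue measure on the types and the valuations up to `P`. -/
def box (M : InsuranceMarket) (P : ℝ) : Measure (ℝ × ℝ) :=
  (volume.restrict (Ioo M.θlo M.θhi)).prod (volume.restrict (M.lowValuations P))

/-- The joint density of types and valuations. -/
def jointDensity (M : InsuranceMarket) (z : ℝ × ℝ) : ℝ := M.h z.1 z.2 * M.f z.1

/-- The virtual value at price `0`, weighted by the joint density. -/
def weightedJ (M : InsuranceMarket) (z : ℝ × ℝ) : ℝ := M.J 0 z.1 z.2 * M.h z.1 z.2 * M.f z.1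

instance isFiniteMeasure_lowValuations (P : ℝ) :
    IsFiniteMeasure (volume.restrict (M.lowValuations P)) :=
  ⟨by
    rw [Measure.restrict_apply_univ]
    exact (measure_mono (M.lowValuations_subset_Icc P)).trans_lt measure_Icc_lt_top⟩

instance isFiniteMeasure_box (P : ℝ) : IsFiniteMeasure (M.box P) := by
  unfold box
  infer_instance

/-- Allows different prices to be compared inside one measure: changing the price only moves a cut
in the second coordinate. -/
theorem box_eq_restrict (M : InsuranceMarket) {p P : ℝ} (h : p ≤ P) :
    M.box p = (M.box P).restrict (Prod.snd ⁻¹' Iic p) := by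
  rw [box, box, ← M.lowValuations_inter_Iic h, inter_comm,
    ← Measure.restrict_restrict measurableSet_Iic, ← univ_prod, ← Measure.prod_restrict,
    Measure.restrict_univ]

theorem ae_box (M : InsuranceMarket) (P : ℝ) :
    ∀ᵐ z ∂M.box P, z.1 ∈ Ioo M.θlo M.θhi ∧ z.2 ∈ M.lowValuations P := by
  rw [box, Measure.prod_restrict]
  exact ae_restrict_mem (measurableSet_Ioo.prod (M.measurableSet_lowValuations P))

theorem box_snd_eq (M : InsuranceMarket) (P p : ℝ) : M.box P (Prod.snd ⁻¹' {p}) = 0 := by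
  rw [box, ← univ_prod, Measure.prod_prod]
  simp

/-! ### Integrability of the density and of the virtual value -/

namespace Regular

variable (hM : M.Regular)
include hM

theorem aestronglyMeasurable_h (P : ℝ) :
    AEStronglyMeasurable (fun z : ℝ × ℝ => M.h z.1 z.2) (M.box P) := by
  have hm : ∀ n : ℕ, Measurable fun z : ℝ × ℝ =>
      slope (M.Hclamp z.1) z.2 (z.2 + 1 / ((n : ℝ) + 1)) := fun n => by
    simp only [slope_def_field]
    have h1 : Measurable fun z : ℝ × ℝ => M.Hclamp z.1 (z.2 + 1 / ((n : ℝ) + 1)) :=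
      hM.measurable_Hclamp.comp (measurable_fst.prodMk (measurable_snd.add_const _))
    have h2 : Measurable fun z : ℝ × ℝ => M.Hclamp z.1 z.2 := hM.measurable_Hclamp
    exact (h1.sub h2).div ((measurable_snd.add_const _).sub measurable_snd)
  have ht : ∀ᵐ z ∂M.box P, Tendsto (fun n : ℕ =>
      slope (M.Hclamp z.1) z.2 (z.2 + 1 / ((n : ℝ) + 1))) atTop (𝓝 (M.h z.1 z.2)) := by
    filter_upwards [M.ae_box P] with z hz
    exact hM.tendsto_slope_h (Ioo_subset_Icc_self hz.1) hz.2.1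
  exact (aemeasurable_of_tendsto_metrizable_ae' (fun n => (hm n).aemeasurable)
    ht).aestronglyMeasurable

theorem aestronglyMeasurable_dH (P : ℝ) :
    AEStronglyMeasurable (fun z : ℝ × ℝ => M.dH z.1 z.2) (M.box P) := by
  have hm : ∀ n : ℕ, Measurable fun z : ℝ × ℝ =>
      slope (fun s => M.Hclamp s z.2) z.1 (z.1 + 1 / ((n : ℝ) + 1)) := fun n => by
    simp only [slope_def_field]
    have h1 : Measurable fun z : ℝ × ℝ => M.Hclamp (z.1 + 1 / ((n : ℝ) + 1)) z.2 := by
      have hs : Measurable fun z : ℝ × ℝ => (z.1 + 1 / ((n : ℝ) + 1), z.2) := by fun_prop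
      simpa only [Function.comp_def, Function.uncurry_apply_pair] using
        hM.measurable_Hclamp.comp hs
    have h2 : Measurable fun z : ℝ × ℝ => M.Hclamp z.1 z.2 := hM.measurable_Hclamp
    exact (h1.sub h2).div ((measurable_fst.add_const _).sub measurable_fst)
  have ht : ∀ᵐ z ∂M.box P, Tendsto (fun n : ℕ =>
      slope (fun s => M.Hclamp s z.2) z.1 (z.1 + 1 / ((n : ℝ) + 1))) atTop
        (𝓝 (M.dH z.1 z.2)) := by
    filter_upwards [M.ae_box P] with z hz
    exact hM.tendsto_slope_dH hz.1 hz.2.1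
  exact (aemeasurable_of_tendsto_metrizable_ae' (fun n => (hm n).aemeasurable)
    ht).aestronglyMeasurable

theorem aestronglyMeasurable_comp_H {u : ℝ → ℝ} (hu : ContinuousOn u (Icc 0 1)) (P : ℝ) :
    AEStronglyMeasurable (fun z : ℝ × ℝ => u (M.H z.1 z.2)) (M.box P) := by
  have hc : Continuous fun q : ℝ => u (max 0 (min 1 q)) :=
    hu.comp_continuous (by fun_prop) fun q =>
      ⟨le_max_left _ _, max_le zero_le_one (min_le_left _ _)⟩
  refine (hc.measurable.comp hM.measurable_Hclamp).aestronglyMeasurable.congr ?_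
  filter_upwards [M.ae_box P] with z hz
  have hH := M.H_mem_Icc z.1 z.2
  simp only [Function.comp, Function.uncurry, Hclamp_eq (Ioo_subset_Icc_self hz.1)]
  rw [min_eq_right hH.2, max_eq_right hH.1]

omit hM in
theorem aestronglyMeasurable_type {u : ℝ → ℝ} (hu : ContinuousOn u M.Θ) (P : ℝ) :
    AEStronglyMeasurable (fun z : ℝ × ℝ => u z.1) (M.box P) := by
  have : AEStronglyMeasurable u (volume.restrict (Ioo M.θlo M.θhi)) :=
    (hu.mono Ioo_subset_Icc_self).aestronglyMeasurable measurableSet_Ioo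
  exact this.comp_fst

theorem continuousOn_F : ContinuousOn M.F M.Θ := by
  have h : IntegrableOn M.f (Icc M.θlo M.θhi) := hM.f_cont.integrableOn_Icc
  exact intervalIntegral.continuousOn_primitive_interval (by rwa [uIcc_of_le hM.type_lt.le])
    |>.mono (by rw [uIcc_of_le hM.type_lt.le]; exact le_rfl)

theorem integrable_h {P : ℝ} (hP : 0 ≤ P) :
    Integrable (fun z : ℝ × ℝ => M.h z.1 z.2) (M.box P) := by
  refine (integrable_prod_iff (hM.aestronglyMeasurable_h P)).2 ⟨?_, ?_⟩
  · filter_upwards [ae_restrict_mem measurableSet_Ioo] with θ hθ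
    exact (hM.integral_h (Ioo_subset_Icc_self hθ) hP).1
  · refine Integrable.mono' (integrable_const (1 : ℝ))
      (hM.aestronglyMeasurable_h P).norm.integral_prod_right' ?_
    filter_upwards [ae_restrict_mem measurableSet_Ioo] with θ hθ
    have hθ' : θ ∈ M.Θ := Ioo_subset_Icc_self hθ
    have h1 : ∫ b in M.lowValuations P, ‖M.h θ b‖ = M.H θ P - M.H θ 0 := by
      rw [← (hM.integral_h hθ' hP).2]
      exact setIntegral_congr_fun (M.measurableSet_lowValuations P) fun b hb =>
        Real.norm_of_nonneg (hM.h_pos θ hθ' b hb.1).le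
    rw [h1, Real.norm_of_nonneg (sub_nonneg.2 (M.monotone_H θ hP))]
    linarith [(M.H_mem_Icc θ P).2, (M.H_mem_Icc θ 0).1]

/-- Stochastic dominance fixes the sign of the derivative, so integrating its norm over types first
telescopes to an increment of `H`, at most `1`. Hence Fubini is used in the opposite order to
`integrable_h`. -/
theorem integrable_dH (P : ℝ) : Integrable (fun z : ℝ × ℝ => M.dH z.1 z.2) (M.box P) := by
  refine (integrable_prod_iff' (hM.aestronglyMeasurable_dH P)).2 ⟨?_, ?_⟩
  · filter_upwards [ae_restrict_mem (M.measurableSet_lowValuations P)] with b hb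
    exact (hM.integral_dH hb.1).1
  · refine Integrable.mono' (integrable_const (1 : ℝ))
      (hM.aestronglyMeasurable_dH P).norm.prod_swap.integral_prod_right' ?_
    filter_upwards [ae_restrict_mem (M.measurableSet_lowValuations P)] with b hb
    have h1 : ∫ θ in Ioo M.θlo M.θhi, ‖M.dH θ b‖ = M.H M.θlo b - M.H M.θhi b := by
      rw [← neg_sub, ← (hM.integral_dH hb.1).2, ← integral_neg]
      exact integral_congr_ae (Eventually.of_forall fun θ =>
        Real.norm_of_nonpos (hM.dH_nonpos θ b))
    rw [h1, Real.norm_eq_abs, abs_le]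
    constructor <;>
      linarith [(M.H_mem_Icc M.θlo b).2, (M.H_mem_Icc M.θlo b).1, (M.H_mem_Icc M.θhi b).2,
        (M.H_mem_Icc M.θhi b).1]

omit hM in
/-- An integrable function stays integrable after multiplication by a continuous function of the
type. -/
theorem integrable_type_mul {u : ℝ → ℝ} {v : ℝ × ℝ → ℝ} {P : ℝ} (hu : ContinuousOn u M.Θ)
    (hv : Integrable v (M.box P)) : Integrable (fun z => u z.1 * v z) (M.box P) := by
  obtain ⟨C, hC⟩ := isCompact_Icc.exists_bound_of_continuousOn hu
  refine hv.bdd_mul (c := C) (aestronglyMeasurable_type hu P) ?_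
  filter_upwards [M.ae_box P] with z hz
  exact hC _ (Ioo_subset_Icc_self hz.1)

/-- An integrable function stays integrable after multiplication by a continuous function of
`H_θ(b)`. -/
theorem integrable_comp_H_mul {u : ℝ → ℝ} {v : ℝ × ℝ → ℝ} {P : ℝ}
    (hu : ContinuousOn u (Icc 0 1)) (hv : Integrable v (M.box P)) :
    Integrable (fun z => u (M.H z.1 z.2) * v z) (M.box P) := by
  obtain ⟨C, hC⟩ := isCompact_Icc.exists_bound_of_continuousOn hu
  exact hv.bdd_mul (c := C) (hM.aestronglyMeasurable_comp_H hu P)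
    (Eventually.of_forall fun _ => hC _ (M.H_mem_Icc _ _))

theorem integrable_jointDensity {P : ℝ} (hP : 0 ≤ P) : Integrable M.jointDensity (M.box P) :=
  (integrable_type_mul hM.f_cont (hM.integrable_h hP)).congr
    (Eventually.of_forall fun _ => mul_comm _ _)

theorem jointDensity_pos (P : ℝ) : ∀ᵐ z ∂M.box P, 0 < M.jointDensity z := by
  filter_upwards [M.ae_box P] with z hz
  have hθ : z.1 ∈ M.Θ := Ioo_subset_Icc_self hz.1
  exact mul_pos (hM.h_pos _ hθ _ hz.2.1) (hM.f_pos _ hθ)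

/-- The weight `h f` cancels the denominators `h` and `f` of the virtual value. What remains is a
sum of bounded factors times a constant, `dH` or the joint density. -/
theorem integrable_weightedJ {P : ℝ} (hP : 0 ≤ P) : Integrable M.weightedJ (M.box P) := by
  have h1 : Integrable (fun z : ℝ × ℝ => M.f z.1 * ((1 - M.g (M.H z.1 z.2)) * 1)) (M.box P) :=
    integrable_type_mul hM.f_cont (hM.integrable_comp_H_mul (u := fun q => 1 - M.g q)
      (continuousOn_const.sub hM.g_smooth.continuousOn) (integrable_const 1))
  have hg' : ContinuousOn M.g' (Icc 0 1) :=
    hM.g_smooth.continuousOn_derivWithin (uniqueDiffOn_Icc zero_lt_one) le_rfl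
  have h2 : Integrable (fun z : ℝ × ℝ => (1 - M.F z.1) * (M.g' (M.H z.1 z.2) * M.dH z.1 z.2))
      (M.box P) :=
    integrable_type_mul (u := fun θ => 1 - M.F θ) (continuousOn_const.sub hM.continuousOn_F)
      (hM.integrable_comp_H_mul hg' (hM.integrable_dH P))
  have h3 : Integrable (fun z : ℝ × ℝ => z.2 * M.jointDensity z) (M.box P) := by
    refine (hM.integrable_jointDensity hP).bdd_mul (c := P)
      measurable_snd.aestronglyMeasurable ?_
    filter_upwards [M.ae_box P] with z hz
    rw [Real.norm_of_nonneg hz.2.1.1]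
    exact hz.2.2
  have h4 : Integrable (fun z : ℝ × ℝ => M.f z.1 * ((1 - M.H z.1 z.2) * 1)) (M.box P) :=
    integrable_type_mul hM.f_cont (hM.integrable_comp_H_mul (u := fun q => 1 - q)
      (by fun_prop) (integrable_const 1))
  refine (((h1.add h2).add h3).sub h4).congr ?_
  filter_upwards [M.ae_box P] with z hz
  have hθ : z.1 ∈ M.Θ := Ioo_subset_Icc_self hz.1
  have hh := (hM.h_pos _ hθ _ hz.2.1).ne'
  have hf := (hM.f_pos _ hθ).ne'
  simp only [Pi.add_apply, Pi.sub_apply, weightedJ, J, jointDensity]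
  field_simp
  ring

/-! ### Demand and profit as integrals over the box -/

/-- Fubini's theorem in the form used by demand and profit. -/
theorem integral_box {u : ℝ → ℝ → ℝ} {p : ℝ}
    (hu : Integrable (fun z : ℝ × ℝ => u z.1 z.2 * M.f z.1) (M.box p)) :
    ∫ θ in M.θlo..M.θhi, (∫ b in M.lowValuations p, u θ b) * M.f θ =
      ∫ z, u z.1 z.2 * M.f z.1 ∂M.box p := by
  rw [intervalIntegral.integral_of_le hM.type_lt.le, integral_Ioc_eq_integral_Ioo, box,
    integral_prod _ hu]
  simp only [integral_mul_const]

omit hM in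
/-- Allocations are bounded measurable multipliers on the box. -/
theorem integrable_alloc_mul {x : ℝ → ℝ → ℝ} {v : ℝ × ℝ → ℝ} {P : ℝ}
    (hx : Measurable (Function.uncurry x)) (hx' : ∀ θ ∈ M.Θ, ∀ b ∈ M.B, x θ b ∈ Icc (0 : ℝ) 1)
    (hv : Integrable v (M.box P)) : Integrable (fun z => x z.1 z.2 * v z) (M.box P) := by
  refine hv.bdd_mul (c := 1) hx.aestronglyMeasurable ?_
  filter_upwards [M.ae_box P] with z hz
  have := hx' z.1 (Ioo_subset_Icc_self hz.1) z.2 hz.2.1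
  rw [Real.norm_of_nonneg this.1]
  exact this.2

theorem insuredDemand_eq {x : ℝ → ℝ → ℝ} {p : ℝ} (hp : 0 ≤ p)
    (hx : Measurable (Function.uncurry x)) (hx' : ∀ θ ∈ M.Θ, ∀ b ∈ M.B, x θ b ∈ Icc (0 : ℝ) 1) :
    M.insuredDemand x p = ∫ z, x z.1 z.2 * M.jointDensity z ∂M.box p := by
  have := integrable_alloc_mul hx hx' (hM.integrable_jointDensity hp)
  simp only [jointDensity, ← mul_assoc] at this ⊢
  exact hM.integral_box (u := fun θ b => x θ b * M.h θ b) this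

theorem profit_eq {x : ℝ → ℝ → ℝ} {p : ℝ} (hp : 0 ≤ p) (hx : M.Feasible p x) (β : ℝ) :
    M.profit β p x =
      (∫ z, x z.1 z.2 * M.weightedJ z ∂M.box p) - p * M.RS p + M.K β p := by
  have h1 := integrable_alloc_mul hx.meas hx.mem (hM.integrable_jointDensity hp)
  have h2 := integrable_alloc_mul hx.meas hx.mem (hM.integrable_weightedJ hp)
  -- The price enters the virtual value only as `-p`, and market clearing turns the resulting term
  -- into `p * RS p`, the same for every feasible allocation.
  have key : (fun z : ℝ × ℝ => x z.1 z.2 * M.J p z.1 z.2 * M.h z.1 z.2 * M.f z.1) =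
      fun z => x z.1 z.2 * M.weightedJ z - p * (x z.1 z.2 * M.jointDensity z) := by
    funext z
    simp only [weightedJ, jointDensity, J]
    ring
  have h3 : Integrable (fun z : ℝ × ℝ => x z.1 z.2 * M.J p z.1 z.2 * M.h z.1 z.2 * M.f z.1)
      (M.box p) := by
    rw [key]
    exact h2.sub (h1.const_mul p)
  rw [profit, hM.integral_box (u := fun θ b => x θ b * M.J p θ b * M.h θ b) h3, key,
    integral_sub h2 (h1.const_mul p), integral_const_mul, ← hM.insuredDemand_eq hp hx.meas hx.mem,
    hx.eq]

theorem integrable_H_mul (p : ℝ) :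
    IntegrableOn (fun θ => M.H θ p * M.f θ) (Ioo M.θlo M.θhi) := by
  have hf : IntegrableOn M.f (Ioo M.θlo M.θhi) :=
    hM.f_cont.integrableOn_Icc.mono_set Ioo_subset_Icc_self
  have h1 : Integrable (fun θ => M.Hclamp θ p * M.f θ) (volume.restrict (Ioo M.θlo M.θhi)) :=
    hf.bdd_mul (c := 1) (hM.antitone_Hclamp p).measurable.aestronglyMeasurable
      (Eventually.of_forall fun θ => by
        have := M.H_mem_Icc (max M.θlo (min M.θhi θ)) p
        rw [Hclamp, Real.norm_of_nonneg this.1]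
        exact this.2)
  refine h1.congr ?_
  filter_upwards [ae_restrict_mem measurableSet_Ioo] with θ hθ
  rw [Hclamp_eq (Ioo_subset_Icc_self hθ)]

/-- Total demand under full coverage does not depend on the price. -/
theorem highDemand_add {p : ℝ} (hp : 0 ≤ p) :
    M.highDemand p + ∫ z, M.jointDensity z ∂M.box p = M.highDemand 0 := by
  have hf : IntegrableOn M.f (Ioo M.θlo M.θhi) :=
    hM.f_cont.integrableOn_Icc.mono_set Ioo_subset_Icc_self
  have hi : ∀ q, IntegrableOn (fun θ => (1 - M.H θ q) * M.f θ) (Ioo M.θlo M.θhi) := fun q =>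
    (hf.sub (hM.integrable_H_mul q)).congr (Eventually.of_forall fun θ => by
      simp only [Pi.sub_apply]
      ring)
  have h1 : ∫ z, M.jointDensity z ∂M.box p =
      ∫ θ in Ioo M.θlo M.θhi, (M.H θ p - M.H θ 0) * M.f θ := by
    rw [box, integral_prod _ (hM.integrable_jointDensity hp)]
    refine setIntegral_congr_fun measurableSet_Ioo fun θ hθ => ?_
    simp only [jointDensity]
    rw [integral_mul_const, (hM.integral_h (Ioo_subset_Icc_self hθ) hp).2]
  have h2 : IntegrableOn (fun θ => (M.H θ p - M.H θ 0) * M.f θ) (Ioo M.θlo M.θhi) :=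
    ((hM.integrable_H_mul p).sub (hM.integrable_H_mul 0)).congr (Eventually.of_forall fun θ => by
      simp only [Pi.sub_apply]
      ring)
  rw [h1, highDemand, highDemand, intervalIntegral.integral_of_le hM.type_lt.le,
    intervalIntegral.integral_of_le hM.type_lt.le, integral_Ioc_eq_integral_Ioo,
    integral_Ioc_eq_integral_Ioo, ← integral_add (hi p) h2]
  congr 1
  funext θ
  ring

end Regular

/-! ### Uniform integral estimates -/

/-- If `w` is positive, then a multiplier with values in `[0,1]` and a small integral against `w`
has a small integral against any given integrable function. -/
theorem exists_delta_integral_mul_le {Ω : Type*} [MeasurableSpace Ω] {μ : Measure Ω}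
    {w φ : Ω → ℝ} (hw : Integrable w μ) (hpos : ∀ᵐ z ∂μ, 0 < w z) (hφ : Integrable φ μ)
    {ε : ℝ} (hε : 0 < ε) :
    ∃ δ > 0, ∀ y : Ω → ℝ, AEStronglyMeasurable y μ → (∀ᵐ z ∂μ, y z ∈ Icc (0 : ℝ) 1) →
      ∫ z, y z * w z ∂μ ≤ δ → ∫ z, y z * |φ z| ∂μ ≤ ε := by
  -- Bound `|φ|` by `n * w` plus this excess, whose integral tends to zero by dominated convergence
  -- because `w > 0`.
  have hint : ∀ n : ℕ, Integrable (fun z => max (|φ z| - n * w z) 0) μ := fun n =>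
    (hφ.abs.sub (hw.const_mul _)).pos_part
  have hlim : Tendsto (fun n : ℕ => ∫ z, max (|φ z| - n * w z) 0 ∂μ) atTop (𝓝 (∫ _, 0 ∂μ)) := by
    refine tendsto_integral_of_dominated_convergence (fun z => |φ z|)
      (fun n => (hint n).aestronglyMeasurable) hφ.abs (fun n => ?_) ?_
    · filter_upwards [hpos] with z hz
      rw [Real.norm_of_nonneg (le_max_right _ _)]
      exact max_le (sub_le_self _ (by positivity)) (abs_nonneg _)
    · filter_upwards [hpos] with z hz
      refine tendsto_const_nhds.congr' ?_
      obtain ⟨m, hm⟩ := exists_nat_ge (|φ z| / w z)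
      filter_upwards [eventually_ge_atTop m] with n hn
      refine (max_eq_right ?_).symm
      rw [div_le_iff₀ hz] at hm
      have : (m : ℝ) * w z ≤ n * w z := by gcongr
      linarith
  rw [integral_zero] at hlim
  obtain ⟨n, hn⟩ := (hlim.eventually (gt_mem_nhds (half_pos hε))).exists
  -- Chosen so that `n * δ ≤ ε / 2`; `n + 1` avoids dividing by zero when `n = 0`.
  refine ⟨ε / (2 * ((n : ℝ) + 1)), by positivity, fun y hy hy01 hyw => ?_⟩
  have hbdd : ∀ᵐ z ∂μ, ‖y z‖ ≤ 1 := by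
    filter_upwards [hy01] with z hz
    rw [Real.norm_of_nonneg hz.1]
    exact hz.2
  have h1 : Integrable (fun z => y z * w z) μ := hw.bdd_mul hy hbdd
  have h2 : Integrable (fun z => y z * |φ z|) μ := hφ.abs.bdd_mul hy hbdd
  calc ∫ z, y z * |φ z| ∂μ
      ≤ ∫ z, (n * (y z * w z) + max (|φ z| - n * w z) 0) ∂μ := by
        refine integral_mono_ae h2 ((h1.const_mul _).add (hint n)) ?_
        filter_upwards [hy01] with z hz
        have h3 : y z * (|φ z| - n * w z) ≤ y z * max (|φ z| - n * w z) 0 :=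
          mul_le_mul_of_nonneg_left (le_max_left _ _) hz.1
        have h4 : y z * max (|φ z| - n * w z) 0 ≤ 1 * max (|φ z| - n * w z) 0 :=
          mul_le_mul_of_nonneg_right hz.2 (le_max_right _ _)
        linarith
    _ = n * ∫ z, y z * w z ∂μ + ∫ z, max (|φ z| - n * w z) 0 ∂μ := by
        rw [integral_add (h1.const_mul _) (hint n), integral_const_mul]
    _ ≤ n * (ε / (2 * ((n : ℝ) + 1))) + ε / 2 := by gcongr
    _ ≤ ε := by
        have h5 : (n : ℝ) * (ε / (2 * ((n : ℝ) + 1))) ≤ ε / 2 := by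
          rw [← mul_div_assoc, div_le_div_iff₀ (by positivity) two_pos]
          nlinarith
        linarith

/-- The integral over a half space is continuous in its boundary. -/
theorem continuous_integral_snd_le {μ : Measure (ℝ × ℝ)} {ψ : ℝ × ℝ → ℝ} (hψ : Integrable ψ μ)
    (hμ : ∀ p, μ (Prod.snd ⁻¹' {p}) = 0) :
    Continuous fun p : ℝ => ∫ z in Prod.snd ⁻¹' Iic p, ψ z ∂μ := by
  have hS : ∀ p : ℝ, MeasurableSet (Prod.snd ⁻¹' Iic p : Set (ℝ × ℝ)) := fun p =>
    measurable_snd measurableSet_Iic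
  simp_rw [← integral_indicator (hS _)]
  refine continuous_iff_continuousAt.2 fun p => continuousAt_of_dominated (bound := fun z => ‖ψ z‖)
    (Eventually.of_forall fun q => hψ.aestronglyMeasurable.indicator (hS q))
    (Eventually.of_forall fun q => Eventually.of_forall fun z => norm_indicator_le_norm_self _ _)
    hψ.norm ?_
  have hae : ∀ᵐ z ∂μ, z ∉ (Prod.snd ⁻¹' {p} : Set (ℝ × ℝ)) := measure_eq_zero_iff_ae_notMem.1 (hμ p)
  filter_upwards [hae] with z hz
  rcases lt_or_gt_of_ne (show z.2 ≠ p from hz) with h | h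
  · refine continuousAt_const.congr (f := fun _ => ψ z) ?_
    filter_upwards [lt_mem_nhds h] with q hq
    exact (indicator_of_mem (s := Prod.snd ⁻¹' Iic q) (a := z) hq.le ψ).symm
  · refine continuousAt_const.congr (f := fun _ => (0 : ℝ)) ?_
    filter_upwards [gt_mem_nhds h] with q hq
    exact (indicator_of_notMem (s := Prod.snd ⁻¹' Iic q) (a := z) hq.not_ge ψ).symm

/-- Both differences are integrals over the strip between the two cuts. With `v` fixed, this
controls the effect of a price change uniformly over all allocations. -/
theorem abs_integral_snd_le_sub_le {μ : Measure (ℝ × ℝ)} {u v : ℝ × ℝ → ℝ} (hu : Integrable u μ)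
    (hv : Integrable v μ) (huv : ∀ᵐ z ∂μ, |u z| ≤ v z) (p q : ℝ) :
    |∫ z in Prod.snd ⁻¹' Iic q, u z ∂μ - ∫ z in Prod.snd ⁻¹' Iic p, u z ∂μ| ≤
      |∫ z in Prod.snd ⁻¹' Iic q, v z ∂μ - ∫ z in Prod.snd ⁻¹' Iic p, v z ∂μ| := by
  wlog hpq : p ≤ q generalizing p q
  · rw [abs_sub_comm, abs_sub_comm (∫ z in _, v z ∂μ)]
    exact this q p (le_of_not_ge hpq)
  have hS : MeasurableSet (Prod.snd ⁻¹' Iic p : Set (ℝ × ℝ)) := measurable_snd measurableSet_Iic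
  have hsub : (Prod.snd ⁻¹' Iic p : Set (ℝ × ℝ)) ⊆ Prod.snd ⁻¹' Iic q :=
    preimage_mono (Iic_subset_Iic.2 hpq)
  rw [← setIntegral_sdiff hS hu.integrableOn hsub, ← setIntegral_sdiff hS hv.integrableOn hsub]
  refine (abs_integral_le_integral_abs).trans (le_trans ?_ (le_abs_self _))
  exact integral_mono_ae hu.abs.integrableOn hv.integrableOn (ae_restrict_of_ae huv)

/-! ### The premium term of the profit -/

theorem antitone_one_sub_g_H (hM : M.Regular) (θ : ℝ) :
    Antitone fun b => 1 - M.g (M.H θ b) := fun _ _ h =>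
  sub_le_sub_left (hM.g_mono (M.H_mem_Icc _ _) (M.H_mem_Icc _ _) (M.monotone_H θ h)) _

theorem K_eq (hM : M.Regular) (β p : ℝ) :
    M.K β p = ∫ b in p..(β + p), (1 - M.g (M.H M.θlo b)) := by
  have hi : ∀ a b, IntervalIntegrable (fun b => 1 - M.g (M.H M.θlo b)) volume a b := fun a b =>
    (antitone_one_sub_g_H hM M.θlo).intervalIntegrable
  rw [K, UNP, neg_neg]
  exact intervalIntegral.integral_interval_sub_left (hi _ _) (hi _ _)

theorem continuous_K (hM : M.Regular) (β : ℝ) : Continuous (M.K β) := by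
  have hi : ∀ a b, IntervalIntegrable (fun b => 1 - M.g (M.H M.θlo b)) volume a b := fun a b =>
    (antitone_one_sub_g_H hM M.θlo).intervalIntegrable
  have hc := intervalIntegral.continuous_primitive hi 0
  have : M.K β = fun p => (∫ b in (0 : ℝ)..(β + p), (1 - M.g (M.H M.θlo b))) -
      ∫ b in (0 : ℝ)..p, (1 - M.g (M.H M.θlo b)) := by
    funext p
    rw [K, UNP, neg_neg]
  rw [this]
  exact (hc.comp (continuous_const.add continuous_id)).sub hc

/-- A larger premium matters less at a higher price. -/
theorem antitone_K_sub (hM : M.Regular) {β β' : ℝ} (hβ : β' ≤ β) :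
    Antitone fun p => M.K β p - M.K β' p := by
  have hi : ∀ a b, IntervalIntegrable (fun b => 1 - M.g (M.H M.θlo b)) volume a b := fun a b =>
    (antitone_one_sub_g_H hM M.θlo).intervalIntegrable
  -- Translating by `p` makes the interval of integration independent of the price, leaving a
  -- monotone integrand.
  have key : ∀ p, M.K β p - M.K β' p = ∫ b in β'..β, (1 - M.g (M.H M.θlo (b + p))) := fun p => by
    rw [K_eq hM, K_eq hM, intervalIntegral.integral_interval_sub_left (hi _ _) (hi _ _),
      intervalIntegral.integral_comp_add_right (fun b => 1 - M.g (M.H M.θlo b))]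
  have hs : ∀ p, IntervalIntegrable (fun b => 1 - M.g (M.H M.θlo (b + p))) volume β' β := fun p =>
    Antitone.intervalIntegrable fun _ _ h =>
      antitone_one_sub_g_H hM M.θlo (add_le_add_left h p)
  intro p q hpq
  dsimp only
  rw [key, key]
  exact intervalIntegral.integral_mono_on hβ (hs q) (hs p) fun b _ =>
    antitone_one_sub_g_H hM M.θlo (by linarith)

/-! ### Feasibility and upper semicontinuity of the first-stage value -/

namespace Regular

variable (hM : M.Regular)
include hM

/-- Exhibits residual supply as a constant plus two terms increasing in the price, which gives its
sign, its upper bound and its continuity. -/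
theorem RS_eq {p : ℝ} (hp : 0 ≤ p) :
    M.RS p = M.S p - M.highDemand 0 + ∫ z, M.jointDensity z ∂M.box p := by
  rw [RS, ← hM.highDemand_add hp]
  ring

theorem S_fullCoverage {pF : ℝ} (hF : M.IsFullCoveragePrice pF) : M.S pF = M.highDemand 0 := by
  have h := hF.2
  rw [demand, hM.insuredDemand_eq hF.1.le measurable_const fun _ _ _ _ =>
    right_mem_Icc.2 zero_le_one] at h
  simp only [one_mul] at h
  rw [← h, ← hM.highDemand_add hF.1.le, add_comm]

theorem integral_jointDensity_mono {p q : ℝ} (hq : 0 ≤ q) (hpq : p ≤ q) :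
    ∫ z, M.jointDensity z ∂M.box p ≤ ∫ z, M.jointDensity z ∂M.box q := by
  rw [M.box_eq_restrict hpq]
  exact setIntegral_le_integral (hM.integrable_jointDensity hq)
    ((hM.jointDensity_pos q).mono fun _ h => h.le)

theorem RS_nonneg {pN p : ℝ} (hN : M.IsNoCoveragePrice pN) (hp : pN ≤ p) : 0 ≤ M.RS p := by
  have h0 : 0 ≤ p := hN.1.le.trans hp
  have h := hN.2
  simp only [demand, insuredDemand, zero_mul, integral_zero, intervalIntegral.integral_zero,
    zero_add] at h
  have h1 : M.RS pN = 0 := by rw [RS, h, sub_self]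
  rw [hM.RS_eq hN.1.le] at h1
  rw [hM.RS_eq h0]
  linarith [hM.integral_jointDensity_mono h0 hp, hM.S_mono.monotoneOn hN.1.le h0 hp]

theorem RS_le {pF p : ℝ} (hF : M.IsFullCoveragePrice pF) (hp0 : 0 ≤ p) (hp : p ≤ pF) :
    M.RS p ≤ ∫ z, M.jointDensity z ∂M.box p := by
  rw [hM.RS_eq hp0]
  linarith [hM.S_fullCoverage hF, hM.S_mono.monotoneOn hp0 hF.1.le hp]

/-- Any monotone allocation becomes feasible after a change whose size is the excess supply. -/
theorem exists_feasible_near {x : ℝ → ℝ → ℝ} {p : ℝ} (hp : 0 ≤ p)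
    (hRS : M.RS p ∈ Icc 0 (∫ z, M.jointDensity z ∂M.box p))
    (hx : Measurable (Function.uncurry x)) (hx' : ∀ θ ∈ M.Θ, ∀ b ∈ M.B, x θ b ∈ Icc (0 : ℝ) 1)
    (hmono : ∀ θ ∈ M.Θ, MonotoneOn (x θ) M.B) :
    ∃ x', M.Feasible p x' ∧ ∫ z, |x' z.1 z.2 - x z.1 z.2| * M.jointDensity z ∂M.box p =
      |M.RS p - M.insuredDemand x p| := by
  have hw := hM.integrable_jointDensity hp
  have hxw := integrable_alloc_mul hx hx' hw
  have hD := hM.insuredDemand_eq hp hx hx'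
  set W := ∫ z, M.jointDensity z ∂M.box p
  set D := M.insuredDemand x p
  have hD0 : 0 ≤ D := by
    rw [hD]
    refine integral_nonneg_of_ae ?_
    filter_upwards [M.ae_box p, hM.jointDensity_pos p] with z hz hz'
    exact mul_nonneg (hx' _ (Ioo_subset_Icc_self hz.1) _ hz.2.1).1 hz'.le
  have hDW : D ≤ W := by
    rw [hD]
    refine integral_mono_ae hxw hw ?_
    filter_upwards [M.ae_box p, hM.jointDensity_pos p] with z hz hz'
    exact mul_le_of_le_one_left hz'.le (hx' _ (Ioo_subset_Icc_self hz.1) _ hz.2.1).2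
  rcases le_total D (M.RS p) with hle | hle
  -- With too little demand, mix `x` with full coverage. Monotonicity in `b` survives, and the
  -- change has one sign, so its weighted size equals the gap exactly.
  · obtain ⟨t, ht, hteq⟩ : ∃ t ∈ Icc (0 : ℝ) 1, t * (W - D) = M.RS p - D := by
      rcases hDW.eq_or_lt with h | h
      · exact ⟨0, by simp, by linarith [hRS.2]⟩
      · have h' : 0 < W - D := sub_pos.2 h
        exact ⟨(M.RS p - D) / (W - D), ⟨div_nonneg (by linarith) h'.le,
          (div_le_one h').2 (by linarith [hRS.2])⟩, div_mul_cancel₀ _ h'.ne'⟩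
    have hm : Measurable (Function.uncurry fun θ b => x θ b + t * (1 - x θ b)) :=
      hx.add ((measurable_const.sub hx).const_mul t)
    have hmem : ∀ θ ∈ M.Θ, ∀ b ∈ M.B, x θ b + t * (1 - x θ b) ∈ Icc (0 : ℝ) 1 := by
      intro θ hθ b hb
      obtain ⟨h0, h1⟩ := hx' θ hθ b hb
      constructor <;> nlinarith [ht.1, ht.2]
    have hchange : ∫ z, t * (1 - x z.1 z.2) * M.jointDensity z ∂M.box p = M.RS p - D := by
      rw [← hteq, hD, ← integral_sub hw hxw, ← integral_const_mul]
      congr 1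
      funext z
      ring
    have hci : Integrable (fun z => t * (1 - x z.1 z.2) * M.jointDensity z) (M.box p) :=
      ((hw.sub hxw).const_mul t).congr (Eventually.of_forall fun z => by
        simp only [Pi.sub_apply]
        ring)
    refine ⟨fun θ b => x θ b + t * (1 - x θ b), ⟨hm, hmem, fun θ hθ b hb c hc hbc => ?_, ?_⟩, ?_⟩
    · nlinarith [hmono θ hθ hb hc hbc, ht.2]
    · rw [hM.insuredDemand_eq hp hm hmem]
      simp only [add_mul (x _ _)]
      rw [integral_add hxw hci, hchange, ← hD]
      ring
    · rw [abs_of_nonneg (sub_nonneg.2 hle), ← hchange]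
      refine integral_congr_ae ?_
      filter_upwards [M.ae_box p] with z hz
      have h1 := (hx' _ (Ioo_subset_Icc_self hz.1) _ hz.2.1).2
      rw [add_sub_cancel_left, abs_of_nonneg (mul_nonneg ht.1 (sub_nonneg.2 h1))]
  -- With too much demand, mix with no coverage, that is, scale `x` down.
  · obtain ⟨t, ht, hteq⟩ : ∃ t ∈ Icc (0 : ℝ) 1, t * D = M.RS p := by
      rcases hD0.eq_or_lt with h | h
      · exact ⟨0, by simp, by linarith [hRS.1]⟩
      · exact ⟨M.RS p / D, ⟨div_nonneg hRS.1 h.le, (div_le_one h).2 hle⟩,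
          div_mul_cancel₀ _ h.ne'⟩
    have hm : Measurable (Function.uncurry fun θ b => t * x θ b) := hx.const_mul t
    have hmem : ∀ θ ∈ M.Θ, ∀ b ∈ M.B, t * x θ b ∈ Icc (0 : ℝ) 1 := by
      intro θ hθ b hb
      obtain ⟨h0, h1⟩ := hx' θ hθ b hb
      exact ⟨mul_nonneg ht.1 h0, mul_le_one₀ ht.2 h0 h1⟩
    refine ⟨fun θ b => t * x θ b, ⟨hm, hmem, fun θ hθ b hb c hc hbc => ?_, ?_⟩, ?_⟩
    · exact mul_le_mul_of_nonneg_left (hmono θ hθ hb hc hbc) ht.1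
    · rw [hM.insuredDemand_eq hp hm hmem]
      simp only [mul_assoc]
      rw [integral_const_mul, ← hD, hteq]
    · have hc : (1 - t) * D = D - M.RS p := by rw [← hteq]; ring
      rw [abs_of_nonpos (sub_nonpos.2 hle), neg_sub, ← hc, hD, ← integral_const_mul]
      refine integral_congr_ae ?_
      filter_upwards [M.ae_box p] with z hz
      have h0 := (hx' _ (Ioo_subset_Icc_self hz.1) _ hz.2.1).1
      have h1 : t * x z.1 z.2 - x z.1 z.2 = -((1 - t) * x z.1 z.2) := by ring
      rw [h1, abs_neg, abs_of_nonneg (mul_nonneg (sub_nonneg.2 ht.2) h0), mul_assoc]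

/-- The allocation part of profit is bounded. -/
theorem integral_alloc_weightedJ_le {x : ℝ → ℝ → ℝ} {p : ℝ} (hp : 0 ≤ p)
    (hx : Measurable (Function.uncurry x)) (hx' : ∀ θ ∈ M.Θ, ∀ b ∈ M.B, x θ b ∈ Icc (0 : ℝ) 1) :
    ∫ z, x z.1 z.2 * M.weightedJ z ∂M.box p ≤ ∫ z, |M.weightedJ z| ∂M.box p := by
  have hφ := hM.integrable_weightedJ hp
  refine integral_mono_ae (integrable_alloc_mul hx hx' hφ) hφ.abs ?_
  filter_upwards [M.ae_box p] with z hz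
  have h := hx' _ (Ioo_subset_Icc_self hz.1) _ hz.2.1
  calc x z.1 z.2 * M.weightedJ z ≤ x z.1 z.2 * |M.weightedJ z| :=
        mul_le_mul_of_nonneg_left (le_abs_self _) h.1
    _ ≤ |M.weightedJ z| := mul_le_of_le_one_left (abs_nonneg _) h.2

theorem continuousOn_RS (P : ℝ) : ContinuousOn M.RS (Icc 0 P) := by
  rcases lt_or_ge P 0 with hP | hP
  · rw [Icc_eq_empty_of_lt hP]
    exact continuousOn_empty _
  have hc := continuous_integral_snd_le (hM.integrable_jointDensity hP) (M.box_snd_eq P)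
  refine (((hM.S_smooth.continuousOn.mono Icc_subset_Ici_self).sub
    (continuousOn_const (c := M.highDemand 0))).add hc.continuousOn).congr fun p hp => ?_
  rw [hM.RS_eq hp.1, M.box_eq_restrict hp.2]
  rfl

/-- The value of the first-stage problem is upper semicontinuous in the price. -/
theorem upperSemicontinuousOn_Profit {pN pF : ℝ} (hN : M.IsNoCoveragePrice pN)
    (hF : M.IsFullCoveragePrice pF) (β : ℝ) :
    UpperSemicontinuousOn (M.Profit β) (Icc pN pF) := by
  intro p hp y hy
  have hp0 : 0 ≤ p := hN.1.le.trans hp.1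
  have hsub : Icc pN pF ⊆ Icc 0 pF := Icc_subset_Icc_left hN.1.le
  have hRS : ∀ q ∈ Icc pN pF, M.RS q ∈ Icc 0 (∫ z, M.jointDensity z ∂M.box q) := fun q hq =>
    ⟨hM.RS_nonneg hN hq.1, hM.RS_le hF (hsub hq).1 hq.2⟩
  -- Three errors of size `ε` occur: moving the cut from `q` to `p`, repairing the allocation, and
  -- the change of `K - q * RS`. The fourth quarter keeps the final inequality strict.
  set ε := (y - M.Profit β p) / 4 with hεdef
  have hε : 0 < ε := by
    have := sub_pos.2 hy
    positivity
  obtain ⟨δ, hδ, hUI⟩ := exists_delta_integral_mul_le (hM.integrable_jointDensity hp0)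
    (hM.jointDensity_pos p) (hM.integrable_weightedJ hp0) hε
  have hw := hM.integrable_jointDensity hF.1.le
  have hφ := hM.integrable_weightedJ hF.1.le
  have hRSc := (hM.continuousOn_RS pF).mono hsub
  have hac : ContinuousOn (fun q => M.K β q - q * M.RS q) (Icc pN pF) :=
    (continuous_K hM β).continuousOn.sub (continuousOn_id.mul hRSc)
  have near : ∀ {u : ℝ → ℝ} {η : ℝ}, ContinuousOn u (Icc pN pF) → 0 < η →
      ∀ᶠ q in 𝓝[Icc pN pF] p, |u q - u p| < η := fun hu hη =>
    (hu p hp).tendsto.eventually (Metric.ball_mem_nhds _ hη)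
  filter_upwards [near (continuous_integral_snd_le hw (M.box_snd_eq pF)).continuousOn (half_pos hδ),
    near (continuous_integral_snd_le hφ.abs (M.box_snd_eq pF)).continuousOn hε,
    near hRSc (half_pos hδ), near hac hε, self_mem_nhdsWithin] with q hqW hqΦ hqRS hqa hq
  have hq0 : 0 ≤ q := (hsub hq).1
  -- Repairing the zero allocation shows that the feasible set is nonempty, so that the supremum
  -- over it can be bounded.
  obtain ⟨x₀, hx₀, -⟩ := hM.exists_feasible_near (x := fun _ _ => 0) hq0 (hRS q hq)
    measurable_const (fun _ _ _ _ => left_mem_Icc.2 zero_le_one) fun _ _ => monotoneOn_const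
  refine lt_of_le_of_lt (b := M.Profit β p + 3 * ε) ?_ (by linarith)
  refine csSup_le ⟨_, x₀, hx₀, rfl⟩ ?_
  rintro v ⟨x, hx, rfl⟩
  obtain ⟨x', hx', hxx'⟩ := hM.exists_feasible_near hp0 (hRS p hp) hx.meas hx.mem hx.mono
  have hbdd : BddAbove {v | ∃ x, M.Feasible p x ∧ v = M.profit β p x} := by
    refine ⟨(∫ z, |M.weightedJ z| ∂M.box p) - p * M.RS p + M.K β p, ?_⟩
    rintro v ⟨x, hx, rfl⟩
    rw [hM.profit_eq hp0 hx]
    linarith [hM.integral_alloc_weightedJ_le hp0 hx.meas hx.mem]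
  have hle : M.profit β p x' ≤ M.Profit β p := le_csSup hbdd ⟨x', hx', rfl⟩
  have hmul : ∀ {v : ℝ × ℝ → ℝ} {ν : ℝ}, ∀ᵐ z ∂M.box ν, |x z.1 z.2 * v z| ≤ |v z| := by
    intro v ν
    filter_upwards [M.ae_box ν] with z hz
    have h := hx.mem _ (Ioo_subset_Icc_self hz.1) _ hz.2.1
    rw [abs_mul, abs_of_nonneg h.1]
    exact mul_le_of_le_one_left (abs_nonneg _) h.2
  have h1 : |(∫ z, x z.1 z.2 * M.weightedJ z ∂M.box q) -
      ∫ z, x z.1 z.2 * M.weightedJ z ∂M.box p| < ε := by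
    rw [M.box_eq_restrict hq.2, M.box_eq_restrict hp.2]
    exact (abs_integral_snd_le_sub_le (integrable_alloc_mul hx.meas hx.mem hφ) hφ.abs hmul
      p q).trans_lt hqΦ
  -- Since `x` clears the market at `q`, this is the demand of the strip between `p` and `q`. The
  -- continuity of `RS` supplies the other `δ / 2`.
  have h2 : |M.RS q - M.insuredDemand x p| < δ / 2 := by
    rw [← hx.eq, hM.insuredDemand_eq hq0 hx.meas hx.mem, hM.insuredDemand_eq hp0 hx.meas hx.mem,
      M.box_eq_restrict hq.2, M.box_eq_restrict hp.2]
    refine (abs_integral_snd_le_sub_le (integrable_alloc_mul hx.meas hx.mem hw) hw ?_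
      p q).trans_lt hqW
    filter_upwards [hmul (v := M.jointDensity), hM.jointDensity_pos pF] with z hz hz'
    rwa [abs_of_pos hz'] at hz
  have h3 : |M.RS p - M.insuredDemand x p| ≤ δ := by
    rw [abs_lt] at h2 hqRS
    rw [abs_le]
    constructor <;> linarith [h2.1, h2.2, hqRS.1, hqRS.2]
  have h4 : ∫ z, |x' z.1 z.2 - x z.1 z.2| * |M.weightedJ z| ∂M.box p ≤ ε := by
    refine hUI _ (hx'.meas.sub hx.meas).abs.aestronglyMeasurable ?_ (hxx'.trans_le h3)
    filter_upwards [M.ae_box p] with z hz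
    have ha := hx.mem _ (Ioo_subset_Icc_self hz.1) _ hz.2.1
    have hb := hx'.mem _ (Ioo_subset_Icc_self hz.1) _ hz.2.1
    refine ⟨abs_nonneg _, ?_⟩
    rw [abs_le]
    constructor <;> linarith [ha.1, ha.2, hb.1, hb.2]
  have h5 : (∫ z, x z.1 z.2 * M.weightedJ z ∂M.box p) -
      ∫ z, x' z.1 z.2 * M.weightedJ z ∂M.box p ≤ ε := by
    have hφp := hM.integrable_weightedJ hp0
    rw [← integral_sub (integrable_alloc_mul hx.meas hx.mem hφp)
      (integrable_alloc_mul hx'.meas hx'.mem hφp)]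
    refine (le_abs_self _).trans (abs_integral_le_integral_abs.trans (le_trans (le_of_eq ?_) h4))
    congr 1
    funext z
    rw [← sub_mul, abs_mul, abs_sub_comm]
  rw [hM.profit_eq hq0 hx]
  rw [hM.profit_eq hp0 hx'] at hle
  rw [abs_lt] at h1 hqa
  linarith [h1.1, h1.2, hqa.1, hqa.2]

/-- The premium enters the value of the first-stage problem additively. -/
theorem Profit_sub_Profit {pN pF p : ℝ} (hN : M.IsNoCoveragePrice pN)
    (hF : M.IsFullCoveragePrice pF) (hp : p ∈ Icc pN pF) (β β' : ℝ) :
    M.Profit β p - M.Profit β' p = M.K β p - M.K β' p := by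
  have hp0 : 0 ≤ p := hN.1.le.trans hp.1
  obtain ⟨x₀, hx₀, -⟩ := hM.exists_feasible_near (x := fun _ _ => 0) hp0
    ⟨hM.RS_nonneg hN hp.1, hM.RS_le hF hp0 hp.2⟩
    measurable_const (fun _ _ _ _ => left_mem_Icc.2 zero_le_one) fun _ _ => monotoneOn_const
  -- One inequality for arbitrary premiums, used in both directions: the same allocations are
  -- feasible under each.
  have key : ∀ β₁ β₂, M.Profit β₁ p ≤ M.Profit β₂ p + (M.K β₁ p - M.K β₂ p) := by
    intro β₁ β₂
    refine csSup_le ⟨_, x₀, hx₀, rfl⟩ ?_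
    rintro v ⟨x, hx, rfl⟩
    have hbdd : BddAbove {v | ∃ x, M.Feasible p x ∧ v = M.profit β₂ p x} := by
      refine ⟨(∫ z, |M.weightedJ z| ∂M.box p) - p * M.RS p + M.K β₂ p, ?_⟩
      rintro v ⟨x, hx, rfl⟩
      rw [hM.profit_eq hp0 hx]
      linarith [hM.integral_alloc_weightedJ_le hp0 hx.meas hx.mem]
    have hle : M.profit β₂ p x ≤ M.Profit β₂ p := le_csSup hbdd ⟨x, hx, rfl⟩
    rw [profit] at hle ⊢
    linarith
  linarith [key β β', key β' β]

end Regular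

end InsuranceMarket

end

theorem mainTheorem9 (M : InsuranceMarket) (hM : M.Regular)
    (pN pF : ℝ) (hN : M.IsNoCoveragePrice pN) (hF : M.IsFullCoveragePrice pF)
    (β β' : ℝ) (hβ' : 0 ≤ β') (hβ : β' < β) :
    ¬ ∃ p, M.SolvesSecondStage pN pF β p ∧
      ∀ p', M.SolvesSecondStage pN pF β' p' → p' < p := by
  rintro ⟨p, ⟨hp, hmax⟩, hlt⟩
  have hsub : Icc p pF ⊆ Icc pN pF := Icc_subset_Icc_left hp.1
  -- Maximizing only over `[p, pF]` forces `p ≤ p'`; it remains to see that prices below `p` do no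
  -- better under `β'`.
  obtain ⟨p', hp', hmax'⟩ := ((hM.upperSemicontinuousOn_Profit hN hF β').mono
    hsub).exists_isMaxOn ⟨p, left_mem_Icc.2 hp.2⟩ isCompact_Icc
  refine (hlt p' ⟨hsub hp', fun q hq => ?_⟩).not_ge hp'.1
  rcases le_total p q with h | h
  · exact hmax' ⟨h, hq.2⟩
  · have h1 : M.Profit β' p ≤ M.Profit β' p' := hmax' (left_mem_Icc.2 hp.2)
    have h2 : M.Profit β q ≤ M.Profit β p := hmax hq
    have h3 := InsuranceMarket.antitone_K_sub hM hβ.le h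
    have h4 := hM.Profit_sub_Profit hN hF hq β β'
    have h5 := hM.Profit_sub_Profit hN hF hp β β'
    show M.Profit β' q ≤ M.Profit β' p'
    dsimp only at h3
    linarith
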